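/- Let $\mathbb{X}$ be a finite set, $\alpha>1$, and let $\mathcal P(\mathbb{X})$ be the set of probability measures on $\mathbb{X}$, viewed as a subset of $\mathbb{R}^{\mathbb{X}}$ with the usual topology; write $\mathrm{Supp}(P)=\{x:P(x)>0\}$ and $[u]_+=\max\{u,0\}$. For $P,Q\in\mathcal P(\mathbb{X})$ let \[ \mathscr I_\alpha(P,Q)=\frac{\alpha}{1-\alpha}\log\sum_x P(x)Q(x)^{\alpha-1}-\frac1{1-\alpha}\log\sum_x P(x)^\alpha+\log\sum_x Q(x)^\alpha , \] which is $+\infty$ exactly when $P$ and $Q$ have disjoint supports. Let $\mathbb{E}\subseteq\mathcal P(\mathbb{X})$. A forward $\mathscr I_\alpha$-projection of $R$ on $\mathbb{E}$ is a $Q\in\mathbb{E}$ with $\mathscr I_\alpha(Q,R)=\inf_{P\in\mathbb{E}}\mathscr I_\alpha(P,R)$, where $\mathscr I_\alpha(P,R)<\infty$ for some $P\in\mathbb{E}$; a reverse $\mathscr I_\alpha$-projection of $R$ on $\mathbb{E}$ is a $Q\in\mathbb{E}$ with $\mathscr I_\alpha(R,Q)=\inf_{P\in\mathbb{E}}\mathscr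 I_\alpha(R,P)$, where $\mathscr I_\alpha(R,P)<\infty$ for some $P\in\mathbb{E}$. For functions $f_1,\dots,f_k:\mathbb{X}\to\mathbb{R}$, the linear family is $\mathbb{L}=\{P\in\mathcal P(\mathbb{X}):\sum_xP(x)f_i(x)=0,\ i=1,\dots,k\}$. For $R\in\mathcal P(\mathbb{X})$ with full support, the $\alpha$-power-law family $\mathbb{M}^{(\alpha)}=\mathbb{M}^{(\alpha)}(R,f_1,\dots,f_k)$ is the set of all $P\in\mathcal P(\mathbb{X})$ such that, for some $\theta\in\mathbb{R}^k$ and $Z>0$, \[ P(x)^{\alpha-1}=Z^{1-\alpha}\Big[R(x)^{\alpha-1}+(1-\alpha)\sum_{i=1}^k\theta_if_i(x)\Big]>0\quad\text{for all }x\in\mathbb{X}. \] If $Q$ is the forward $\mathscr I_\alpha$-projection of $R$ on $\mathbb{L}$ and $\theta^*\in\mathbb{R}^k$ is a parameter of $Q$, i.e. $Q=P_{\theta^*}$ in the sense of (1) below, then the extended family $\hat{\mathbb{M}}^{(\alpha)}_+(R,f_1,\dots,f_k)$ is the set of all $P_\theta\in\mathcal P(\mathbb{X})$, $\theta\in\mathbb{R}^k$,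 such that (1) $Z(\theta)^{\alpha-1}P_\theta(x)^{\alpha-1}=\big[R(x)^{\alpha-1}+(1-\alpha)\sum_i\theta_if_i(x)\big]_+$ for all $x$, with a normalization constant $Z(\theta)>0$; (2) $\mathrm{Supp}(Q)\subseteq\mathrm{Supp}(P_\theta)$; (3) $\sum_i\theta_if_i(x)\le\sum_i\theta_i^*f_i(x)$ for all $x\notin\mathrm{Supp}(P_\theta)$. **Theorem.** Let $\alpha>1$, let $\hat P,R\in\mathcal P(\mathbb{X})$, let $R$ have full support, let $f_1,\dots,f_k:\mathbb{X}\to\mathbb{R}$, and assume that $\mathbb{L}$ is nonempty. Put \[ \tilde f_i=f_i-\tau_i R^{\alpha-1},\qquad \tau_i=\frac{\sum_x\hat P(x)f_i(x)}{\sum_x\hat P(x)R(x)^{\alpha-1}},\qquad \tilde{\mathbb{L}}=\Big\{P\in\mathcal P(\mathbb{X}):\sum_xP(x)\tilde f_i(x)=0,\ i=1,\dots,k\Big\}. \] Then $R$ has exactly one forward $\mathscr I_\alpha$-projection $Q$ on $\tilde{\mathbb{L}}$, and the following hold, where $\mathbb{M}^{(\alpha)}=\mathbb{M}^{(\alpha)}(R,f_1,\dots,f_k)$.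 (a) If $Q\in\mathbb{M}^{(\alpha)}$, then $Q$ is the unique reverse $\mathscr I_\alpha$-projection of $\hat P$ on $\mathbb{M}^{(\alpha)}$. (b) If $Q\in\mathrm{cl}(\mathbb{M}^{(\alpha)})\setminus\mathbb{M}^{(\alpha)}$, then $\hat P$ has no reverse $\mathscr I_\alpha$-projection on $\mathbb{M}^{(\alpha)}$, and $Q$ is the unique reverse $\mathscr I_\alpha$-projection of $\hat P$ on $\mathrm{cl}(\mathbb{M}^{(\alpha)})$. (c) If $Q\notin\mathrm{cl}(\mathbb{M}^{(\alpha)})$, then (i) $\hat P$ has no reverse $\mathscr I_\alpha$-projection on $\mathbb{M}^{(\alpha)}$; and (ii) $Q$ has a parameter $\theta^*$ with respect to $R,\tilde f_1,\dots,\tilde f_k$, and, for every choice of such a parameter $\theta^*$, the extended family $\hat{\mathbb{M}}^{(\alpha)}_+(R,\tilde f_1,\dots,\tilde f_k)$ contains $\mathbb{M}^{(\alpha)}$, and $Q$ is the unique reverse $\mathscr I_\alpha$-projection of $\hat P$ on it. -/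

import Mathlib

/-!  Probability measures on a finite alphabet `X` are the points of `stdSimplex ℝ X`, that is,
the nonnegative functions `P : X → ℝ` with `∑ x, P x = 1`. -/

/-- The relative `α`-entropy of `P` with respect to `Q`,
`α/(1-α) log ∑ P Q^(α-1) - 1/(1-α) log ∑ P^α + log ∑ Q^α`, with values in the extended reals.
The sums are taken in `[0, ∞]` and `log 0 = -∞`, `log ∞ = ∞`, so that the value is `+∞` when
`α > 1` and `P`, `Q` have disjoint supports (and when `α < 1` and `P` is not absolutely
continuous with respect to `Q`). -/
noncomputable def relAlphaEntropy {X : Type*} [Fintype X] (α : ℝ) (P Q : X → ℝ) : EReal :=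
  ((α / (1 - α) : ℝ) : EReal)
      * ENNReal.log (∑ x, ENNReal.ofReal (P x) * ENNReal.ofReal (Q x) ^ (α - 1))
    - ((1 / (1 - α) : ℝ) : EReal) * ENNReal.log (∑ x, ENNReal.ofReal (P x) ^ α)
    + ENNReal.log (∑ x, ENNReal.ofReal (Q x) ^ α)

/-- `Q` is a forward projection of `R` on the set `E` of probability measures: `Q ∈ E` minimizes
`P ↦ relAlphaEntropy α P R` over `E`, this function being finite somewhere on `E`. -/
def IsForwardProj {X : Type*} [Fintype X] (α : ℝ) (R : X → ℝ) (E : Set (X → ℝ))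
    (Q : X → ℝ) : Prop :=
  (∃ P ∈ E, relAlphaEntropy α P R < ⊤) ∧
    Q ∈ E ∧ relAlphaEntropy α Q R = ⨅ P ∈ E, relAlphaEntropy α P R

/-- `Q` is a reverse projection of `R` on the set `E` of probability measures: `Q ∈ E` minimizes
`P ↦ relAlphaEntropy α R P` over `E`, this function being finite somewhere on `E`. -/
def IsReverseProj {X : Type*} [Fintype X] (α : ℝ) (R : X → ℝ) (E : Set (X → ℝ))
    (Q : X → ℝ) : Prop :=
  (∃ P ∈ E, relAlphaEntropy α R P < ⊤) ∧
    Q ∈ E ∧ relAlphaEntropy α R Q = ⨅ P ∈ E, relAlphaEntropy α R P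

/-- `Q` is the one and only reverse projection of `R` on `E`. -/
def IsUniqueReverseProj {X : Type*} [Fintype X] (α : ℝ) (R : X → ℝ) (E : Set (X → ℝ))
    (Q : X → ℝ) : Prop :=
  IsReverseProj α R E Q ∧ ∀ S, IsReverseProj α R E S → S = Q

/-- The linear family characterized by `f 0, …, f (k-1)`. -/
def linearFamily {X : Type*} [Fintype X] {k : ℕ} (f : Fin k → X → ℝ) : Set (X → ℝ) :=
  {P | P ∈ stdSimplex ℝ X ∧ ∀ i, ∑ x, P x * f i x = 0}

/-- The `α`-power-law family characterized by `R` (of full support) and `f 0, …, f (k-1)`: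
the probability measures `P` with
`P(x)^(α-1) = Z^(1-α) [R(x)^(α-1) + (1-α) ∑ i, θ i * f i x] > 0` for all `x`,
for some parameter `θ` and some normalization constant `Z > 0`. -/
def powerLawFamily {X : Type*} [Fintype X] {k : ℕ} (α : ℝ) (R : X → ℝ) (f : Fin k → X → ℝ) :
    Set (X → ℝ) :=
  {P | P ∈ stdSimplex ℝ X ∧ ∃ θ : Fin k → ℝ, ∃ Z : ℝ, 0 < Z ∧ ∀ x,
    0 < R x ^ (α - 1) + (1 - α) * ∑ i, θ i * f i x ∧
    P x ^ (α - 1) = Z ^ (1 - α) * (R x ^ (α - 1) + (1 - α) * ∑ i, θ i * f i x)}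

/-- `P` is the probability measure `P_θ` given by
`Z^(α-1) P(x)^(α-1) = [R(x)^(α-1) + (1-α) ∑ i, θ i * f i x]₊` for all `x` (for `α > 1`), `Z > 0`
being the normalization constant. -/
def HasPlusParameter {X : Type*} [Fintype X] {k : ℕ} (α : ℝ) (R : X → ℝ) (f : Fin k → X → ℝ)
    (θ : Fin k → ℝ) (P : X → ℝ) : Prop :=
  P ∈ stdSimplex ℝ X ∧ ∃ Z : ℝ, 0 < Z ∧ ∀ x,
    Z ^ (α - 1) * P x ^ (α - 1) = max (R x ^ (α - 1) + (1 - α) * ∑ i, θ i * f i x) 0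

/-- The extended family `M̂₊` characterized by `R` and `f` (for `α > 1`). Here `Q` is meant to be
the forward projection of `R` on the linear family of `f`, and `θs` a parameter of `Q`, that is,
`HasPlusParameter α R f θs Q`. -/
def extendedPowerLawFamily {X : Type*} [Fintype X] {k : ℕ} (α : ℝ) (R : X → ℝ)
    (f : Fin k → X → ℝ) (Q : X → ℝ) (θs : Fin k → ℝ) : Set (X → ℝ) :=
  {P | ∃ θ : Fin k → ℝ, HasPlusParameter α R f θ P ∧
    Function.support Q ⊆ Function.support P ∧
    ∀ x, x ∉ Function.support P → ∑ i, θ i * f i x ≤ ∑ i, θs i * f i x}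

/-- The tilted functions `f̃ i = f i - τ i * R^(α-1)`, where
`τ i = (∑ x, P̂ x * f i x) / (∑ x, P̂ x * R x ^ (α-1))`. -/
noncomputable def tilted {X : Type*} [Fintype X] {k : ℕ} (α : ℝ) (Phat R : X → ℝ)
    (f : Fin k → X → ℝ) : Fin k → X → ℝ :=
  fun i x => f i x
    - (∑ y, Phat y * f i y) / (∑ y, Phat y * R y ^ (α - 1)) * R x ^ (α - 1)

/-!
Write `⟪P, Q⟫ = ∑ x, P x * Q x ^ (α - 1)` (`alphaPairing`) and `n P = ∑ x, P x ^ α` (`alphaMass`).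
For `α > 1` the relative entropy of `P` and `Q` is, up to a positive factor, the logarithm of
`n P * n Q ^ (α - 1) / ⟪P, Q⟫ ^ α`, the deficit in Hölder's inequality between `P` and
`Q ^ (α - 1)`. Equality in Hölder's inequality means proportionality, hence equality of probability
vectors (`alphaPairing_rpow_lt`), and every strict comparison below is an instance of this.

*Forward projection.* The tilting is chosen so that `Phat` lies in the tilted linear family, which
is therefore nonempty, and compactness gives a minimizer. Its first variation is nonnegative on a
polyhedral cone, so Farkas' lemma (`exists_sum_mul_le_of_forall_nonneg`) yields the truncated
parametrization (`exists_hasPlusParameter`). Conversely, any member of the linear family with such a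
parametrization is a strict minimizer (`forward_lt_of_hasPlusParameter`), which is uniqueness.

*Reverse projection.* Any two members of the tilted linear family, in particular `Phat` and the
forward projection `Q`, induce proportional functionals `S ↦ ⟪·, S⟫` on the power-law family and, by
continuity, on its closure (`alphaPairing_mul_comm_of_mem_closure`). If `Q` is in that closure, then
minimizing the entropy of `Phat` relative to `S` amounts to minimizing that of `Q` relative to `S`,
and `S = Q` is the only minimizer. On the extended family the proportionality becomes an inequality
in the right direction, because the truncated part is largest for `Q`
(`isUniqueReverseProj_extendedPowerLawFamily`).

*Nonexistence.* The power-law family is relatively open, so a reverse projection on it is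
stationary, which puts it in the tilted linear family (`mem_linearFamily_tilted_of_isReverseProj`).
A common point of the two families is the forward projection, so there is no reverse projection
unless `Q` is in the power-law family.
-/

/-! ### A theorem of the alternative for finite systems of linear inequalities -/

/-- One unknown: the constraints `t * u y ≤ h y` are compatible as soon as every lower bound on `t`
lies below every upper bound. -/
theorem exists_forall_mul_le_of_pairwise {Y : Type*} [Fintype Y] (u h : Y → ℝ)
    (h0 : ∀ x, u x = 0 → 0 ≤ h x)
    (h1 : ∀ x y, 0 < u x → u y < 0 → 0 ≤ -u y * h x + u x * h y) :
    ∃ t : ℝ, ∀ y, t * u y ≤ h y := by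
  have key : ∀ x y, 0 < u x → u y < 0 → h y / u y ≤ h x / u x := by
    intro x y hx hy
    rw [div_le_iff_of_neg hy, div_mul_eq_mul_div, div_le_iff₀ hx]
    linarith [h1 x y hx hy]
  suffices H : ∃ t : ℝ, (∀ x, 0 < u x → t ≤ h x / u x) ∧ ∀ y, u y < 0 → h y / u y ≤ t by
    obtain ⟨t, hp, hn⟩ := H
    refine ⟨t, fun y => ?_⟩
    rcases lt_trichotomy (u y) 0 with hy | hy | hy
    · exact (div_le_iff_of_neg hy).1 (hn y hy)
    · simpa [hy] using h0 y hy
    · exact (le_div_iff₀ hy).1 (hp y hy)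
  by_cases hne : (Finset.univ.filter fun y => u y < 0).Nonempty
  · refine ⟨(Finset.univ.filter fun y => u y < 0).sup' hne fun y => h y / u y, ?_, ?_⟩
    · intro x hx
      exact Finset.sup'_le _ _ fun y hy => key x y hx (Finset.mem_filter.1 hy).2
    · intro y hy
      exact Finset.le_sup' (fun y => h y / u y) (Finset.mem_filter.2 ⟨Finset.mem_univ y, hy⟩)
  · obtain ⟨m, hm⟩ := (Set.finite_range fun x => h x / u x).bddBelow
    refine ⟨m, fun x _ => hm ⟨x, rfl⟩, fun y hy => ?_⟩
    exact (hne ⟨y, Finset.mem_filter.2 ⟨Finset.mem_univ y, hy⟩⟩).elim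

/-- **Farkas' lemma.** If `g` is nonnegative on every nonnegative vector orthogonal to
`f 0, …, f (k-1)`, then `g` dominates a linear combination of the `f i`. The proof is
Fourier–Motzkin elimination of one unknown at a time. -/
theorem exists_sum_mul_le_of_forall_nonneg {k : ℕ} : ∀ {Y : Type*} [Fintype Y]
    (f : Fin k → Y → ℝ) (g : Y → ℝ),
    (∀ P : Y → ℝ, (∀ y, 0 ≤ P y) → (∀ i, ∑ y, P y * f i y = 0) → 0 ≤ ∑ y, P y * g y) →
    ∃ μ : Fin k → ℝ, ∀ y, ∑ i, μ i * f i y ≤ g y := by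
  induction k with
  | zero =>
    intro Y _ f g H
    classical
    refine ⟨0, fun y => ?_⟩
    have := H (Pi.single y 1) (fun z => by by_cases h : z = y <;> simp [h])
      (fun i => i.elim0)
    simpa [Pi.single_apply] using this
  | succ k ih =>
    intro Y _ f g H
    classical
    -- `c (x, y)` combines rows `x` and `y` with nonnegative weights so that `f 0` cancels.
    let c : Y × Y → Y → ℝ := fun z =>
      if 0 < f 0 z.1 ∧ f 0 z.2 < 0 then
        (-f 0 z.2) • Pi.single z.1 1 + f 0 z.1 • Pi.single z.2 1
      else if f 0 z.1 = 0 then Pi.single z.1 1 else 0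
    have hc : ∀ z y, 0 ≤ c z y := by
      intro z y
      have hs : ∀ w : Y, (0 : ℝ) ≤ (Pi.single w (1 : ℝ) : Y → ℝ) y := fun w => by
        by_cases h : y = w <;> simp [h]
      simp only [c]
      split_ifs with h1 h2
      · simp only [Pi.add_apply, Pi.smul_apply, smul_eq_mul]
        exact add_nonneg (mul_nonneg (by linarith [h1.2]) (hs _)) (mul_nonneg h1.1.le (hs _))
      · exact hs _
      · exact le_rfl
    have hcpair : ∀ x y (v : Y → ℝ), 0 < f 0 x → f 0 y < 0 →
        ∑ w, c (x, y) w * v w = -f 0 y * v x + f 0 x * v y := by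
      intro x y v hx hy
      simp only [c]
      rw [if_pos ⟨hx, hy⟩]
      simp [add_mul, Finset.sum_add_distrib, Pi.single_apply]
    have hczero : ∀ x y (v : Y → ℝ), f 0 x = 0 → ∑ w, c (x, y) w * v w = v x := by
      intro x y v hx
      simp only [c]
      rw [if_neg (by rintro ⟨h, -⟩; exact h.ne' hx), if_pos hx]
      simp [Pi.single_apply]
    have hcf : ∀ z, ∑ w, c z w * f 0 w = 0 := by
      rintro ⟨x, y⟩
      by_cases h1 : 0 < f 0 x ∧ f 0 y < 0
      · rw [hcpair x y _ h1.1 h1.2]; ring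
      · by_cases h2 : f 0 x = 0
        · rw [hczero x y _ h2, h2]
        · simp [c, h1, h2]
    have hswap : ∀ (P : Y × Y → ℝ) (v : Y → ℝ),
        ∑ y, (∑ z, P z * c z y) * v y = ∑ z, P z * ∑ y, c z y * v y := by
      intro P v
      simp only [Finset.sum_mul, Finset.mul_sum]
      rw [Finset.sum_comm]
      exact Finset.sum_congr rfl fun _ _ => Finset.sum_congr rfl fun _ _ => by ring
    obtain ⟨μ, hμ⟩ := ih (fun i z => ∑ y, c z y * f i.succ y) (fun z => ∑ y, c z y * g y) (by
      intro P hP hPf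
      rw [← hswap]
      refine H _ (fun y => Finset.sum_nonneg fun z _ => mul_nonneg (hP z) (hc z y)) fun i => ?_
      rw [hswap]
      refine Fin.cases ?_ (fun i => hPf i) i
      simp [hcf])
    have hμ' : ∀ z, 0 ≤ ∑ y, c z y * (g y - ∑ i, μ i * f i.succ y) := by
      intro z
      have := hμ z
      have e : ∑ y, c z y * (g y - ∑ i, μ i * f i.succ y)
          = ∑ y, c z y * g y - ∑ i, μ i * ∑ y, c z y * f i.succ y := by
        simp only [mul_sub, Finset.sum_sub_distrib, Finset.mul_sum]
        congr 1
        rw [Finset.sum_comm]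
        exact Finset.sum_congr rfl fun _ _ => Finset.sum_congr rfl fun _ _ => by ring
      rw [e]; linarith
    obtain ⟨t, ht⟩ := exists_forall_mul_le_of_pairwise (f 0)
      (fun y => g y - ∑ i, μ i * f i.succ y)
      (fun x hx => by have := hμ' (x, x); rwa [hczero x x _ hx] at this)
      (fun x y hx hy => by have := hμ' (x, y); rwa [hcpair x y _ hx hy] at this)
    refine ⟨Fin.cons t μ, fun y => ?_⟩
    rw [Fin.sum_univ_succ]
    simp only [Fin.cons_zero, Fin.cons_succ]
    linarith [ht y]

/-! ### Hölder's inequality and the relative entropy -/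

/-- The pairing `∑ x, P x * Q x ^ (α - 1)`. -/
noncomputable def alphaPairing {X : Type*} [Fintype X] (α : ℝ) (P Q : X → ℝ) : ℝ :=
  ∑ x, P x * Q x ^ (α - 1)

/-- The `α`-th power `∑ x, P x ^ α` of the `ℓ^α` norm of `P ≥ 0`. -/
noncomputable def alphaMass {X : Type*} [Fintype X] (α : ℝ) (P : X → ℝ) : ℝ :=
  ∑ x, P x ^ α

section Entropy

variable {X : Type*} [Fintype X] {α : ℝ} {P Q R S : X → ℝ}

theorem mul_rpow_sub_one_self (hα : 1 < α) {a : ℝ} (ha : 0 ≤ a) : a * a ^ (α - 1) = a ^ α := by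
  rcases ha.eq_or_lt with rfl | h
  · rw [zero_mul, Real.zero_rpow (by linarith)]
  · rw [Real.rpow_sub_one h.ne']; field_simp

theorem alphaPairing_self (hα : 1 < α) (hQ : Q ∈ stdSimplex ℝ X) :
    alphaPairing α Q Q = alphaMass α Q :=
  Finset.sum_congr rfl fun x _ => mul_rpow_sub_one_self hα (hQ.1 x)

theorem exists_pos_of_mem_stdSimplex (hP : P ∈ stdSimplex ℝ X) : ∃ x, 0 < P x := by
  by_contra! h
  have : ∑ x, P x ≤ 0 := Finset.sum_nonpos fun x _ => h x
  linarith [hP.2]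

theorem sum_mul_pos_of_mem_stdSimplex (hP : P ∈ stdSimplex ℝ X) {v : X → ℝ} (hv : ∀ x, 0 < v x) :
    0 < ∑ x, P x * v x := by
  obtain ⟨x, hx⟩ := exists_pos_of_mem_stdSimplex hP
  exact Finset.sum_pos' (fun y _ => mul_nonneg (hP.1 y) (hv y).le)
    ⟨x, Finset.mem_univ x, mul_pos hx (hv x)⟩

theorem alphaPairing_nonneg (hP : P ∈ stdSimplex ℝ X) (hQ : Q ∈ stdSimplex ℝ X) :
    0 ≤ alphaPairing α P Q :=
  Finset.sum_nonneg fun x _ => mul_nonneg (hP.1 x) (Real.rpow_nonneg (hQ.1 x) _)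

theorem alphaPairing_pos (hP : P ∈ stdSimplex ℝ X) (hR : ∀ x, 0 < R x) :
    0 < alphaPairing α P R :=
  sum_mul_pos_of_mem_stdSimplex hP fun x => Real.rpow_pos_of_pos (hR x) _

theorem alphaMass_pos (hP : P ∈ stdSimplex ℝ X) : 0 < alphaMass α P := by
  obtain ⟨x, hx⟩ := exists_pos_of_mem_stdSimplex hP
  exact Finset.sum_pos' (fun y _ => Real.rpow_nonneg (hP.1 y) _)
    ⟨x, Finset.mem_univ x, Real.rpow_pos_of_pos hx _⟩

/-- Strict Hölder inequality for the exponents `α` and `α / (α - 1)`, applied to `Q` and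
`S ^ (α - 1)`: two distinct probability vectors are never proportional, so equality is excluded. -/
theorem alphaPairing_rpow_lt (hα : 1 < α) (hQ : Q ∈ stdSimplex ℝ X) (hS : S ∈ stdSimplex ℝ X)
    (hne : S ≠ Q) :
    alphaPairing α Q S ^ α < alphaMass α Q * alphaMass α S ^ (α - 1) := by
  have hα0 : (0 : ℝ) < α := by linarith
  have hnQ : 0 < alphaMass α Q := alphaMass_pos hQ
  have hnS : 0 < alphaMass α S := alphaMass_pos hS
  have hw : 1 / α + (α - 1) / α = 1 := by field_simp; ring
  set A := alphaMass α Q ^ (1 / α) with hA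
  set B := alphaMass α S ^ ((α - 1) / α) with hB
  have hA0 : 0 < A := Real.rpow_pos_of_pos hnQ _
  have hB0 : 0 < B := Real.rpow_pos_of_pos hnS _
  -- Each summand, after normalization, is a weighted geometric mean.
  have hterm : ∀ x, Q x * S x ^ (α - 1) = A * B *
      ((Q x ^ α / alphaMass α Q) ^ (1 / α) * (S x ^ α / alphaMass α S) ^ ((α - 1) / α)) := by
    intro x
    rw [Real.div_rpow (Real.rpow_nonneg (hQ.1 x) _) hnQ.le,
      Real.div_rpow (Real.rpow_nonneg (hS.1 x) _) hnS.le, ← Real.rpow_mul (hQ.1 x),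
      ← Real.rpow_mul (hS.1 x), mul_one_div_cancel hα0.ne', Real.rpow_one,
      mul_div_cancel₀ _ hα0.ne', ← hA, ← hB]
    field_simp
  have hQ' : ∀ x, 0 ≤ Q x ^ α / alphaMass α Q := fun x =>
    div_nonneg (Real.rpow_nonneg (hQ.1 x) _) hnQ.le
  have hS' : ∀ x, 0 ≤ S x ^ α / alphaMass α S := fun x =>
    div_nonneg (Real.rpow_nonneg (hS.1 x) _) hnS.le
  obtain ⟨x₀, hx₀⟩ : ∃ x, Q x ^ α / alphaMass α Q ≠ S x ^ α / alphaMass α S := by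
    by_contra! h
    apply hne
    have hprop : ∀ x, S x = (alphaMass α S / alphaMass α Q) ^ (1 / α) * Q x := by
      intro x
      have h1 : S x ^ α = alphaMass α S / alphaMass α Q * Q x ^ α := by
        have := h x; field_simp at this ⊢; linarith
      calc S x = (S x ^ α) ^ (1 / α) := by
            rw [← Real.rpow_mul (hS.1 x), mul_one_div_cancel hα0.ne', Real.rpow_one]
        _ = _ := by
            rw [h1, Real.mul_rpow (div_pos hnS hnQ).le (Real.rpow_nonneg (hQ.1 x) _),
              ← Real.rpow_mul (hQ.1 x), mul_one_div_cancel hα0.ne', Real.rpow_one]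
    have h1 : (alphaMass α S / alphaMass α Q) ^ (1 / α) = 1 := by
      have := hS.2
      simp_rw [hprop, ← Finset.mul_sum, hQ.2, mul_one] at this
      exact this
    funext x
    rw [hprop x, h1, one_mul]
  have hlt : ∑ x, (Q x ^ α / alphaMass α Q) ^ (1 / α) * (S x ^ α / alphaMass α S) ^ ((α - 1) / α)
      < ∑ x, (1 / α * (Q x ^ α / alphaMass α Q) + (α - 1) / α * (S x ^ α / alphaMass α S)) := by
    refine Finset.sum_lt_sum (fun x _ => ?_) ⟨x₀, Finset.mem_univ _, ?_⟩
    · exact Real.geom_mean_le_arith_mean2_weighted (by positivity)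
        (div_nonneg (by linarith) hα0.le) (hQ' x) (hS' x) hw
    · exact (Real.geom_mean_lt_arith_mean2_weighted_iff_of_pos (by positivity)
        (div_pos (by linarith) hα0) (hQ' x₀) (hS' x₀) hw).2 hx₀
  have hone : ∑ x, (1 / α * (Q x ^ α / alphaMass α Q) + (α - 1) / α * (S x ^ α / alphaMass α S))
      = 1 := by
    rw [Finset.sum_add_distrib, ← Finset.mul_sum, ← Finset.mul_sum, ← Finset.sum_div,
      ← Finset.sum_div]
    change 1 / α * (alphaMass α Q / alphaMass α Q)
      + (α - 1) / α * (alphaMass α S / alphaMass α S) = 1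
    rw [div_self hnQ.ne', div_self hnS.ne', mul_one, mul_one, hw]
  have hlt' : alphaPairing α Q S < A * B := by
    unfold alphaPairing
    simp_rw [hterm, ← Finset.mul_sum]
    rw [hone] at hlt
    nlinarith [mul_pos hA0 hB0]
  calc alphaPairing α Q S ^ α < (A * B) ^ α :=
        Real.rpow_lt_rpow (alphaPairing_nonneg hQ hS) hlt' hα0
    _ = alphaMass α Q * alphaMass α S ^ (α - 1) := by
        rw [Real.mul_rpow hA0.le hB0.le, hA, hB, ← Real.rpow_mul hnQ.le, ← Real.rpow_mul hnS.le,
          one_div_mul_cancel hα0.ne', Real.rpow_one, div_mul_cancel₀ _ hα0.ne']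

theorem alphaPairing_ofReal (hα : 1 < α) (hP : P ∈ stdSimplex ℝ X) (hQ : Q ∈ stdSimplex ℝ X) :
    ∑ x, ENNReal.ofReal (P x) * ENNReal.ofReal (Q x) ^ (α - 1)
      = ENNReal.ofReal (alphaPairing α P Q) := by
  unfold alphaPairing
  rw [ENNReal.ofReal_sum_of_nonneg fun x _ =>
    mul_nonneg (hP.1 x) (Real.rpow_nonneg (hQ.1 x) _)]
  refine Finset.sum_congr rfl fun x _ => ?_
  rw [ENNReal.ofReal_mul (hP.1 x), ENNReal.ofReal_rpow_of_nonneg (hQ.1 x) (by linarith)]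

theorem alphaMass_ofReal (hα : 1 < α) (hP : P ∈ stdSimplex ℝ X) :
    ∑ x, ENNReal.ofReal (P x) ^ α = ENNReal.ofReal (alphaMass α P) := by
  unfold alphaMass
  rw [ENNReal.ofReal_sum_of_nonneg fun x _ => Real.rpow_nonneg (hP.1 x) _]
  exact Finset.sum_congr rfl fun x _ => ENNReal.ofReal_rpow_of_nonneg (hP.1 x) (by linarith)

theorem relAlphaEntropy_eq_coe (hα : 1 < α) (hP : P ∈ stdSimplex ℝ X) (hQ : Q ∈ stdSimplex ℝ X)
    (h : 0 < alphaPairing α P Q) :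
    relAlphaEntropy α P Q = ((α / (1 - α) * Real.log (alphaPairing α P Q)
      - 1 / (1 - α) * Real.log (alphaMass α P) + Real.log (alphaMass α Q) : ℝ) : EReal) := by
  unfold relAlphaEntropy
  rw [alphaPairing_ofReal hα hP hQ, alphaMass_ofReal hα hP, alphaMass_ofReal hα hQ,
    ENNReal.log_ofReal_of_pos h, ENNReal.log_ofReal_of_pos (alphaMass_pos hP),
    ENNReal.log_ofReal_of_pos (alphaMass_pos hQ)]
  norm_cast

theorem relAlphaEntropy_eq_top (hα : 1 < α) (hP : P ∈ stdSimplex ℝ X) (hQ : Q ∈ stdSimplex ℝ X)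
    (h : alphaPairing α P Q = 0) : relAlphaEntropy α P Q = ⊤ := by
  unfold relAlphaEntropy
  rw [alphaPairing_ofReal hα hP hQ, alphaMass_ofReal hα hP, alphaMass_ofReal hα hQ, h,
    ENNReal.ofReal_zero, ENNReal.log_zero, ENNReal.log_ofReal_of_pos (alphaMass_pos hP),
    ENNReal.log_ofReal_of_pos (alphaMass_pos hQ),
    EReal.coe_mul_bot_of_neg (div_neg_of_pos_of_neg (by linarith) (by linarith)), ← EReal.coe_mul,
    EReal.top_sub_coe, EReal.top_add_coe]

theorem relAlphaEntropy_lt_top_iff (hα : 1 < α) (hP : P ∈ stdSimplex ℝ X)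
    (hQ : Q ∈ stdSimplex ℝ X) : relAlphaEntropy α P Q < ⊤ ↔ 0 < alphaPairing α P Q := by
  constructor
  · intro h
    refine (alphaPairing_nonneg hP hQ).lt_of_ne fun h0 => ?_
    exact h.ne (relAlphaEntropy_eq_top hα hP hQ h0.symm)
  · intro h
    rw [relAlphaEntropy_eq_coe hα hP hQ h]
    exact EReal.coe_lt_top _

theorem relAlphaEntropy_right_le_iff (hα : 1 < α) (hP : P ∈ stdSimplex ℝ X)
    (hQ : Q ∈ stdSimplex ℝ X) (hS : S ∈ stdSimplex ℝ X) (h : 0 < alphaPairing α P Q) :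
    relAlphaEntropy α P Q ≤ relAlphaEntropy α P S ↔
      alphaMass α Q ^ (α - 1) * alphaPairing α P S ^ α
        ≤ alphaMass α S ^ (α - 1) * alphaPairing α P Q ^ α := by
  have hQ0 : 0 < alphaMass α Q := alphaMass_pos hQ
  have hS0 : 0 < alphaMass α S := alphaMass_pos hS
  rcases (alphaPairing_nonneg hP hS).eq_or_lt with h0 | h0
  · rw [relAlphaEntropy_eq_top hα hP hS h0.symm, ← h0, Real.zero_rpow (by linarith), mul_zero]
    exact iff_of_true le_top (by positivity)
  · have hne : α - 1 ≠ 0 := by linarith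
    have hne' : 1 - α ≠ 0 := by linarith
    rw [relAlphaEntropy_eq_coe hα hP hQ h, relAlphaEntropy_eq_coe hα hP hS h0,
      EReal.coe_le_coe_iff,
      ← Real.log_le_log_iff (x := alphaMass α Q ^ (α - 1) * _) (by positivity) (by positivity),
      Real.log_mul (by positivity) (by positivity), Real.log_mul (by positivity) (by positivity),
      Real.log_rpow hQ0, Real.log_rpow hS0, Real.log_rpow h, Real.log_rpow h0,
      ← mul_le_mul_iff_right₀ (show (0 : ℝ) < α - 1 by linarith)]
    have e : ∀ u v w : ℝ, (α - 1) * (α / (1 - α) * u - 1 / (1 - α) * v + w)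
        = -α * u + v + (α - 1) * w := by
      intro u v w; field_simp; ring
    rw [e, e]
    constructor <;> intro _ <;> linarith

theorem relAlphaEntropy_left_le_iff (hα : 1 < α) (hP : P ∈ stdSimplex ℝ X)
    (hR : R ∈ stdSimplex ℝ X) (hS : S ∈ stdSimplex ℝ X) (h : 0 < alphaPairing α P R)
    (h0 : 0 < alphaPairing α S R) :
    relAlphaEntropy α P R ≤ relAlphaEntropy α S R ↔
      alphaMass α P * alphaPairing α S R ^ α ≤ alphaMass α S * alphaPairing α P R ^ α := by
  have hP0 : 0 < alphaMass α P := alphaMass_pos hP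
  have hS0 : 0 < alphaMass α S := alphaMass_pos hS
  have hne' : 1 - α ≠ 0 := by linarith
  rw [relAlphaEntropy_eq_coe hα hP hR h, relAlphaEntropy_eq_coe hα hS hR h0,
    EReal.coe_le_coe_iff,
    ← Real.log_le_log_iff (x := alphaMass α P * _) (by positivity) (by positivity),
    Real.log_mul (by positivity) (by positivity), Real.log_mul (by positivity) (by positivity),
    Real.log_rpow h, Real.log_rpow h0,
    ← mul_le_mul_iff_right₀ (show (0 : ℝ) < α - 1 by linarith)]
  have e : ∀ u v w : ℝ, (α - 1) * (α / (1 - α) * u - 1 / (1 - α) * v + w)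
      = -α * u + v + (α - 1) * w := by
    intro u v w; field_simp; ring
  rw [e, e]
  constructor <;> intro _ <;> linarith

theorem isReverseProj_iff (hα : 1 < α) (hP : P ∈ stdSimplex ℝ X) {E : Set (X → ℝ)}
    (hE : E ⊆ stdSimplex ℝ X) :
    IsReverseProj α P E Q ↔ Q ∈ E ∧ 0 < alphaPairing α P Q ∧ ∀ S ∈ E,
      alphaMass α Q ^ (α - 1) * alphaPairing α P S ^ α
        ≤ alphaMass α S ^ (α - 1) * alphaPairing α P Q ^ α := by
  constructor
  · rintro ⟨⟨S₀, hS₀, hfin⟩, hQ, heq⟩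
    have hle : ∀ S ∈ E, relAlphaEntropy α P Q ≤ relAlphaEntropy α P S := fun S hS =>
      heq.trans_le (iInf₂_le S hS)
    have hpos := (relAlphaEntropy_lt_top_iff hα hP (hE hQ)).1 ((hle S₀ hS₀).trans_lt hfin)
    exact ⟨hQ, hpos, fun S hS =>
      (relAlphaEntropy_right_le_iff hα hP (hE hQ) (hE hS) hpos).1 (hle S hS)⟩
  · rintro ⟨hQ, hpos, hle⟩
    exact ⟨⟨Q, hQ, (relAlphaEntropy_lt_top_iff hα hP (hE hQ)).2 hpos⟩, hQ,
      le_antisymm (le_iInf₂ fun S hS =>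
        (relAlphaEntropy_right_le_iff hα hP (hE hQ) (hE hS) hpos).2 (hle S hS)) (iInf₂_le Q hQ)⟩

theorem isForwardProj_iff (hα : 1 < α) (hR : R ∈ stdSimplex ℝ X) (hRpos : ∀ x, 0 < R x)
    {E : Set (X → ℝ)} (hE : E ⊆ stdSimplex ℝ X) :
    IsForwardProj α R E Q ↔ Q ∈ E ∧ ∀ S ∈ E,
      alphaMass α Q * alphaPairing α S R ^ α ≤ alphaMass α S * alphaPairing α Q R ^ α := by
  have hpos : ∀ S ∈ E, 0 < alphaPairing α S R := fun S hS => alphaPairing_pos (hE hS) hRpos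
  constructor
  · rintro ⟨-, hQ, heq⟩
    exact ⟨hQ, fun S hS => (relAlphaEntropy_left_le_iff hα (hE hQ) hR (hE hS) (hpos Q hQ)
      (hpos S hS)).1 (heq.trans_le (iInf₂_le S hS))⟩
  · rintro ⟨hQ, hle⟩
    exact ⟨⟨Q, hQ, (relAlphaEntropy_lt_top_iff hα (hE hQ) hR).2 (hpos Q hQ)⟩, hQ,
      le_antisymm (le_iInf₂ fun S hS => (relAlphaEntropy_left_le_iff hα (hE hQ) hR (hE hS)
        (hpos Q hQ) (hpos S hS)).2 (hle S hS)) (iInf₂_le Q hQ)⟩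

/-- Comparison of `Q` with `S` in the second argument. The hypothesis says that, relative to the
pairing with `Q`, replacing `Q ^ (α - 1)` by `S ^ (α - 1)` does not increase the pairing with `P`;
the rest is the strict Hölder inequality. -/
theorem reverse_lt_of_alphaPairing_le (hα : 1 < α) (hP : P ∈ stdSimplex ℝ X)
    (hQ : Q ∈ stdSimplex ℝ X) (hS : S ∈ stdSimplex ℝ X) (hne : S ≠ Q)
    (hpos : 0 < alphaPairing α P Q)
    (h : alphaPairing α P S * alphaMass α Q ≤ alphaPairing α Q S * alphaPairing α P Q) :
    alphaMass α Q ^ (α - 1) * alphaPairing α P S ^ α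
      < alphaMass α S ^ (α - 1) * alphaPairing α P Q ^ α := by
  have hα0 : (0 : ℝ) < α := by linarith
  have hQ0 : 0 < alphaMass α Q := alphaMass_pos hQ
  have h1 := alphaPairing_nonneg (α := α) hP hS
  have h2 := alphaPairing_nonneg (α := α) hQ hS
  have h3 := Real.rpow_le_rpow (mul_nonneg h1 hQ0.le) h hα0.le
  rw [Real.mul_rpow h1 hQ0.le, Real.mul_rpow h2 hpos.le,
    ← mul_rpow_sub_one_self hα hQ0.le] at h3
  have h4 := mul_lt_mul_of_pos_right (alphaPairing_rpow_lt hα hQ hS hne)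
    (Real.rpow_pos_of_pos hpos α)
  refine lt_of_mul_lt_mul_left ?_ hQ0.le
  linarith

/-- Comparison of `Q` with `P` in the first argument, again by the strict Hölder inequality. -/
theorem forward_lt_of_alphaPairing_le (hα : 1 < α) (hP : P ∈ stdSimplex ℝ X)
    (hQ : Q ∈ stdSimplex ℝ X) (hR : R ∈ stdSimplex ℝ X) (hne : P ≠ Q)
    (hpos : 0 < alphaPairing α Q R)
    (h : alphaMass α Q * alphaPairing α P R ≤ alphaPairing α P Q * alphaPairing α Q R) :
    alphaMass α Q * alphaPairing α P R ^ α < alphaMass α P * alphaPairing α Q R ^ α := by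
  have hα0 : (0 : ℝ) < α := by linarith
  have hQ0 : 0 < alphaMass α Q := alphaMass_pos hQ
  have h1 := alphaPairing_nonneg (α := α) hP hR
  have h2 := alphaPairing_nonneg (α := α) hP hQ
  have h3 := Real.rpow_le_rpow (mul_nonneg hQ0.le h1) h hα0.le
  rw [Real.mul_rpow hQ0.le h1, Real.mul_rpow h2 hpos.le,
    ← mul_rpow_sub_one_self hα hQ0.le] at h3
  have h4 := mul_lt_mul_of_pos_right (alphaPairing_rpow_lt hα hP hQ hne.symm)
    (Real.rpow_pos_of_pos hpos α)
  refine lt_of_mul_lt_mul_left ?_ (Real.rpow_pos_of_pos hQ0 (α - 1)).le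
  linarith

end Entropy

/-! ### The truncated parametrization and forward projections -/

section Forward

variable {X : Type*} [Fintype X] {k : ℕ} {α : ℝ} {g : Fin k → X → ℝ} {P Q R S : X → ℝ}

theorem linearFamily_subset_stdSimplex : linearFamily g ⊆ stdSimplex ℝ X := fun _ h => h.1

theorem sum_mul_affine_eq {V : X → ℝ} (hV : ∀ i, ∑ x, V x * g i x = 0) (r : X → ℝ) (a : ℝ)
    (θ : Fin k → ℝ) :
    ∑ x, V x * (r x + a * ∑ i, θ i * g i x) = ∑ x, V x * r x := by
  have : ∑ x, V x * ∑ i, θ i * g i x = 0 := by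
    simp only [Finset.mul_sum]
    rw [Finset.sum_comm]
    refine Finset.sum_eq_zero fun i _ => ?_
    calc ∑ x, V x * (θ i * g i x) = θ i * ∑ x, V x * g i x := by
          rw [Finset.mul_sum]; exact Finset.sum_congr rfl fun _ _ => by ring
      _ = 0 := by rw [hV i, mul_zero]
  calc ∑ x, V x * (r x + a * ∑ i, θ i * g i x)
      = ∑ x, V x * r x + a * ∑ x, V x * ∑ i, θ i * g i x := by
        rw [Finset.mul_sum, ← Finset.sum_add_distrib]
        exact Finset.sum_congr rfl fun _ _ => by ring
    _ = _ := by rw [this, mul_zero, add_zero]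

/-- The negative part of the bracket in the truncated parametrization. -/
noncomputable def bracketNegPart (α : ℝ) (R : X → ℝ) (g : Fin k → X → ℝ) (θ : Fin k → ℝ) (x : X) :
    ℝ :=
  max (-(R x ^ (α - 1) + (1 - α) * ∑ i, θ i * g i x)) 0

/-- On the linear family the bracket pairs like `R ^ (α - 1)`, so truncating it adds exactly the
pairing with its negative part. -/
theorem mul_alphaPairing_of_plusParameter {θ : Fin k → ℝ} {c : ℝ} (hS : S ∈ linearFamily g)
    (hc : ∀ x, c * P x ^ (α - 1) = max (R x ^ (α - 1) + (1 - α) * ∑ i, θ i * g i x) 0) :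
    c * alphaPairing α S P = alphaPairing α S R + ∑ x, S x * bracketNegPart α R g θ x := by
  have h := sum_mul_affine_eq hS.2 (fun x => R x ^ (α - 1)) (1 - α) θ
  unfold alphaPairing
  rw [← h, Finset.mul_sum, ← Finset.sum_add_distrib]
  refine Finset.sum_congr rfl fun x _ => ?_
  rw [← mul_add, mul_left_comm, hc x]
  congr 1
  have := max_zero_sub_max_neg_zero_eq_self (R x ^ (α - 1) + (1 - α) * ∑ i, θ i * g i x)
  unfold bracketNegPart
  linarith

theorem sum_mul_bracketNegPart_eq_zero {θ : Fin k → ℝ} {c : ℝ} (hcpos : 0 < c)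
    (hP : P ∈ stdSimplex ℝ X)
    (hc : ∀ x, c * P x ^ (α - 1) = max (R x ^ (α - 1) + (1 - α) * ∑ i, θ i * g i x) 0)
    (hQ : ∀ x, Q x ≠ 0 → P x ≠ 0) :
    ∑ x, Q x * bracketNegPart α R g θ x = 0 := by
  refine Finset.sum_eq_zero fun x _ => ?_
  by_cases hx : Q x = 0
  · rw [hx, zero_mul]
  · have h : 0 < max (R x ^ (α - 1) + (1 - α) * ∑ i, θ i * g i x) 0 :=
      hc x ▸ mul_pos hcpos (Real.rpow_pos_of_pos ((hP.1 x).lt_of_ne (hQ x hx).symm) _)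
    have h' := (lt_max_iff.1 h).resolve_right (lt_irrefl _)
    rw [bracketNegPart, max_eq_right (by linarith), mul_zero]

/-- The optimality condition `HasPlusParameter` is sufficient, with strict inequality away from
`Q`. -/
theorem forward_lt_of_hasPlusParameter (hα : 1 < α) (hR : R ∈ stdSimplex ℝ X)
    (hRpos : ∀ x, 0 < R x) {θ : Fin k → ℝ} (hQ : Q ∈ linearFamily g)
    (hθ : HasPlusParameter α R g θ Q) (hP : P ∈ linearFamily g) (hne : P ≠ Q) :
    alphaMass α Q * alphaPairing α P R ^ α < alphaMass α P * alphaPairing α Q R ^ α := by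
  obtain ⟨-, Z, hZ, hc⟩ := hθ
  have hc0 : 0 < Z ^ (α - 1) := Real.rpow_pos_of_pos hZ _
  have hposQ : 0 < alphaPairing α Q R := alphaPairing_pos hQ.1 hRpos
  refine forward_lt_of_alphaPairing_le hα hP.1 hQ.1 hR hne hposQ ?_
  have h1 := mul_alphaPairing_of_plusParameter hQ hc
  rw [sum_mul_bracketNegPart_eq_zero hc0 hQ.1 hc fun _ h => h, add_zero,
    alphaPairing_self hα hQ.1] at h1
  have h2 := mul_alphaPairing_of_plusParameter hP hc
  have h3 : 0 ≤ ∑ x, P x * bracketNegPart α R g θ x :=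
    Finset.sum_nonneg fun x _ => mul_nonneg (hP.1.1 x) (le_max_right _ _)
  refine le_of_mul_le_mul_left ?_ hc0
  calc Z ^ (α - 1) * (alphaMass α Q * alphaPairing α P R)
      = alphaPairing α Q R * alphaPairing α P R := by rw [← h1]; ring
    _ ≤ alphaPairing α Q R * (Z ^ (α - 1) * alphaPairing α P Q) := by
        gcongr; linarith
    _ = _ := by ring

theorem hasDerivAt_sum_add_mul_rpow {p : ℝ} (hp : 1 ≤ p) (u v : X → ℝ) :
    HasDerivAt (fun t : ℝ => ∑ x, (u x + t * v x) ^ p) (∑ x, v x * (p * u x ^ (p - 1))) 0 := by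
  refine HasDerivAt.fun_sum fun x _ => ?_
  have h1 : HasDerivAt (fun t : ℝ => u x + t * v x) (v x) 0 := by
    simpa using ((hasDerivAt_id (0 : ℝ)).mul_const (v x)).const_add (u x)
  have h2 := h1.rpow_const (p := p) (Or.inr hp)
  simpa [mul_assoc] using h2

theorem deriv_nonneg_of_le_right {ψ : ℝ → ℝ} {d : ℝ} (h : HasDerivAt ψ d 0)
    (hmin : ∀ t, 0 ≤ t → ψ 0 ≤ ψ t) : 0 ≤ d := by
  refine ge_of_tendsto h.tendsto_slope_zero_right ?_
  filter_upwards [self_mem_nhdsWithin] with t ht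
  have ht : 0 < t := ht
  rw [zero_add, smul_eq_mul]
  exact mul_nonneg (inv_nonneg.2 ht.le) (sub_nonneg.2 (hmin t ht.le))

/-- Minimality on the linear family, extended by homogeneity to the cone it spans. -/
theorem forward_le_of_cone
    (hmin : ∀ S ∈ linearFamily g,
      alphaMass α Q * alphaPairing α S R ^ α ≤ alphaMass α S * alphaPairing α Q R ^ α)
    (hRpos : ∀ x, 0 < R x) {V : X → ℝ} (hV : ∀ x, 0 ≤ V x) (hsum : 0 < ∑ x, V x)
    (hVg : ∀ i, ∑ x, V x * g i x = 0) :
    alphaMass α Q * (∑ x, V x * R x ^ (α - 1)) ^ α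
      ≤ (∑ x, V x ^ α) * alphaPairing α Q R ^ α := by
  set σ := ∑ x, V x with hσ
  have h := hmin (fun x => V x / σ) ⟨⟨fun x => div_nonneg (hV x) hsum.le, by
    rw [← Finset.sum_div, ← hσ, div_self hsum.ne']⟩, fun i => by
      simp_rw [div_mul_eq_mul_div]
      rw [← Finset.sum_div, hVg i, zero_div]⟩
  have e1 : alphaPairing α (fun x => V x / σ) R = (∑ x, V x * R x ^ (α - 1)) / σ := by
    unfold alphaPairing
    simp_rw [div_mul_eq_mul_div]
    rw [← Finset.sum_div]
  have e2 : alphaMass α (fun x => V x / σ) = (∑ x, V x ^ α) / σ ^ α := by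
    unfold alphaMass
    rw [Finset.sum_div]
    exact Finset.sum_congr rfl fun x _ => Real.div_rpow (hV x) hsum.le _
  rw [e1, e2, Real.div_rpow (Finset.sum_nonneg fun x _ =>
    mul_nonneg (hV x) (Real.rpow_nonneg (hRpos x).le _)) hsum.le, mul_div_assoc',
    div_mul_eq_mul_div] at h
  exact (div_le_div_iff_of_pos_right (Real.rpow_pos_of_pos hsum _)).1 h

/-- The Karush–Kuhn–Tucker condition: a forward projection on a linear family has a parameter.
The first variation of the minimized functional is nonnegative on the cone spanned by the family,
and Farkas' lemma provides the multipliers. -/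
theorem exists_hasPlusParameter (hα : 1 < α) (hRpos : ∀ x, 0 < R x) (hQ : Q ∈ linearFamily g)
    (hmin : ∀ S ∈ linearFamily g,
      alphaMass α Q * alphaPairing α S R ^ α ≤ alphaMass α S * alphaPairing α Q R ^ α) :
    ∃ θ : Fin k → ℝ, HasPlusParameter α R g θ Q := by
  have hα0 : (0 : ℝ) < α := by linarith
  have hβ : 0 < α - 1 := by linarith
  set n := alphaMass α Q with hn
  set a := alphaPairing α Q R with ha
  have hn0 : 0 < n := alphaMass_pos hQ.1
  have ha0 : 0 < a := alphaPairing_pos hQ.1 hRpos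
  obtain ⟨μ, hμ⟩ := exists_sum_mul_le_of_forall_nonneg g
    (fun x => a * Q x ^ (α - 1) - n * R x ^ (α - 1)) (by
    intro P hP hPg
    set b := ∑ x, P x * R x ^ (α - 1) with hb
    have hd1 := (hasDerivAt_sum_add_mul_rpow hα.le Q P).mul_const (a ^ α)
    have hd2 : HasDerivAt (fun t : ℝ => n * (a + t * b) ^ α) (n * (b * α * a ^ (α - 1))) 0 := by
      have h1 : HasDerivAt (fun t : ℝ => a + t * b) b 0 := by
        simpa using ((hasDerivAt_id (0 : ℝ)).mul_const b).const_add a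
      simpa using (h1.rpow_const (p := α) (Or.inr hα.le)).const_mul n
    -- `V = Q + t • P` is in the cone for `t ≥ 0`, so the minimized difference grows from `0`.
    have hd := deriv_nonneg_of_le_right (hd1.sub hd2) (by
      intro t ht
      have h0 : (fun t : ℝ => (∑ x, (Q x + t * P x) ^ α) * a ^ α) 0
          = (fun t : ℝ => n * (a + t * b) ^ α) 0 := by
        simp [hn, alphaMass]
      have h1 := forward_le_of_cone (V := fun x => Q x + t * P x) hmin hRpos
        (fun x => add_nonneg (hQ.1.1 x) (mul_nonneg ht (hP x)))
        (by
          rw [Finset.sum_add_distrib, hQ.1.2]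
          have := Finset.sum_nonneg fun x (_ : x ∈ Finset.univ) => mul_nonneg ht (hP x)
          linarith)
        (fun i => by
          simp_rw [add_mul, mul_assoc]
          rw [Finset.sum_add_distrib, ← Finset.mul_sum, hQ.2 i, hPg i, mul_zero, add_zero])
      have h2 : ∑ x, (Q x + t * P x) * R x ^ (α - 1) = a + t * b := by
        simp_rw [add_mul, mul_assoc]
        rw [Finset.sum_add_distrib, ← Finset.mul_sum]
        rfl
      rw [h2] at h1
      simp only [Pi.sub_apply] at h0 ⊢
      rw [h0, sub_self]
      exact sub_nonneg.2 h1)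
    have e : (∑ x, P x * (α * Q x ^ (α - 1))) * a ^ α - n * (b * α * a ^ (α - 1))
        = α * a ^ (α - 1) * ∑ x, P x * (a * Q x ^ (α - 1) - n * R x ^ (α - 1)) := by
      rw [← mul_rpow_sub_one_self hα ha0.le, hb]
      simp_rw [mul_sub, Finset.sum_sub_distrib, mul_sub]
      have e1 : ∑ x, P x * (α * Q x ^ (α - 1)) = α * ∑ x, P x * Q x ^ (α - 1) := by
        rw [Finset.mul_sum]; exact Finset.sum_congr rfl fun _ _ => by ring
      have e2 : ∑ x, P x * (a * Q x ^ (α - 1)) = a * ∑ x, P x * Q x ^ (α - 1) := by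
        rw [Finset.mul_sum]; exact Finset.sum_congr rfl fun _ _ => by ring
      have e3 : ∑ x, P x * (n * R x ^ (α - 1)) = n * ∑ x, P x * R x ^ (α - 1) := by
        rw [Finset.mul_sum]; exact Finset.sum_congr rfl fun _ _ => by ring
      rw [e1, e2, e3]; ring
    rw [e] at hd
    exact nonneg_of_mul_nonneg_right hd (by positivity))
  -- Complementary slackness: the slack in Farkas' inequality pairs to zero with `Q`.
  have hslack : ∀ x, Q x * (a * Q x ^ (α - 1) - n * R x ^ (α - 1) - ∑ i, μ i * g i x) = 0 := by
    have hs : ∑ x, Q x * (a * Q x ^ (α - 1) - n * R x ^ (α - 1) - ∑ i, μ i * g i x) = 0 := by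
      have h1 := sum_mul_affine_eq hQ.2 (fun x => a * Q x ^ (α - 1) - n * R x ^ (α - 1)) (-1) μ
      have h2 : ∑ x, Q x * (a * Q x ^ (α - 1) - n * R x ^ (α - 1))
          = a * alphaPairing α Q Q - n * alphaPairing α Q R := by
        unfold alphaPairing
        rw [Finset.mul_sum, Finset.mul_sum, ← Finset.sum_sub_distrib]
        exact Finset.sum_congr rfl fun _ _ => by ring
      rw [h2, alphaPairing_self hα hQ.1, ← hn, ← ha] at h1
      simp_rw [neg_one_mul, ← sub_eq_add_neg] at h1
      rw [h1]; ring
    intro x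
    exact (Finset.sum_eq_zero_iff_of_nonneg fun x _ =>
      mul_nonneg (hQ.1.1 x) (sub_nonneg.2 (hμ x))).1 hs x (Finset.mem_univ x)
  refine ⟨fun i => μ i / ((1 - α) * n), hQ.1, (a / n) ^ (1 / (α - 1)),
    Real.rpow_pos_of_pos (div_pos ha0 hn0) _, fun x => ?_⟩
  rw [← Real.rpow_mul (div_pos ha0 hn0).le, one_div_mul_cancel hβ.ne', Real.rpow_one]
  have hne' : 1 - α ≠ 0 := by linarith
  have e : R x ^ (α - 1) + (1 - α) * ∑ i, μ i / ((1 - α) * n) * g i x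
      = (n * R x ^ (α - 1) + ∑ i, μ i * g i x) / n := by
    have : ∑ i, μ i / ((1 - α) * n) * g i x = (∑ i, μ i * g i x) / ((1 - α) * n) := by
      rw [Finset.sum_div]; exact Finset.sum_congr rfl fun _ _ => by ring
    rw [this]; field_simp
  rw [e]
  rcases (hQ.1.1 x).eq_or_lt with hx | hx
  · have h1 := hμ x
    simp only [← hx, Real.zero_rpow hβ.ne', mul_zero, zero_sub] at h1 ⊢
    rw [max_eq_right]
    exact div_nonpos_of_nonpos_of_nonneg (by linarith) hn0.le
  · have h1 := (mul_eq_zero.1 (hslack x)).resolve_left hx.ne'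
    have h2 : n * R x ^ (α - 1) + ∑ i, μ i * g i x = a * Q x ^ (α - 1) := by linarith
    rw [h2, max_eq_left (div_nonneg (mul_nonneg ha0.le (Real.rpow_nonneg hx.le _)) hn0.le)]
    ring

theorem continuous_alphaPairing_left : Continuous fun P : X → ℝ => alphaPairing α P R := by
  unfold alphaPairing; fun_prop

theorem continuous_alphaPairing_right (hα : 1 < α) :
    Continuous fun Q : X → ℝ => alphaPairing α P Q := by
  unfold alphaPairing
  refine continuous_finsetSum _ fun x _ => continuous_const.mul ?_
  exact (continuous_apply x).rpow_const fun _ => Or.inr (by linarith)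

theorem continuous_alphaMass (hα : 1 < α) : Continuous fun P : X → ℝ => alphaMass α P := by
  unfold alphaMass
  refine continuous_finsetSum _ fun x _ => ?_
  exact (continuous_apply x).rpow_const fun _ => Or.inr (by linarith)

theorem isCompact_linearFamily : IsCompact (linearFamily g) := by
  refine (isCompact_stdSimplex ℝ X).of_isClosed_subset ?_ linearFamily_subset_stdSimplex
  have : linearFamily g = stdSimplex ℝ X ∩ ⋂ i, {P | ∑ x, P x * g i x = 0} := by
    ext P; simp [linearFamily]
  rw [this]
  refine (isCompact_stdSimplex ℝ X).isClosed.inter (isClosed_iInter fun i => ?_)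
  exact isClosed_eq (by fun_prop) continuous_const

theorem exists_isForwardProj (hα : 1 < α) (hR : R ∈ stdSimplex ℝ X) (hRpos : ∀ x, 0 < R x)
    (hne : (linearFamily g).Nonempty) : ∃ Q, IsForwardProj α R (linearFamily g) Q := by
  have hpos : ∀ P ∈ linearFamily g, 0 < alphaPairing α P R ^ α := fun P hP =>
    Real.rpow_pos_of_pos (alphaPairing_pos hP.1 hRpos) _
  obtain ⟨Q, hQ, hmin⟩ := isCompact_linearFamily.exists_isMinOn hne
    (f := fun P => alphaMass α P / alphaPairing α P R ^ α)
    ((continuous_alphaMass hα).continuousOn.div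
      (continuous_alphaPairing_left.rpow_const fun _ => Or.inr (by linarith)).continuousOn
      fun P hP => (hpos P hP).ne')
  refine ⟨Q, (isForwardProj_iff hα hR hRpos linearFamily_subset_stdSimplex).2
    ⟨hQ, fun S hS => ?_⟩⟩
  exact (div_le_div_iff₀ (hpos Q hQ) (hpos S hS)).1 (hmin hS)

theorem isForwardProj_unique (hα : 1 < α) (hR : R ∈ stdSimplex ℝ X) (hRpos : ∀ x, 0 < R x)
    (hQ : IsForwardProj α R (linearFamily g) Q) {θ : Fin k → ℝ} (hS : S ∈ linearFamily g)
    (hθ : HasPlusParameter α R g θ S) : Q = S := by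
  by_contra hne
  obtain ⟨hQm, hmin⟩ := (isForwardProj_iff hα hR hRpos linearFamily_subset_stdSimplex).1 hQ
  exact (forward_lt_of_hasPlusParameter hα hR hRpos hS hθ hQm hne).not_ge (hmin S hS)

end Forward

/-! ### The tilted functions and the power-law family -/

section PowerLaw

variable {X : Type*} [Fintype X] {k : ℕ} {α : ℝ} {f : Fin k → X → ℝ} {Phat P Q R S : X → ℝ}

theorem powerLawFamily_subset_stdSimplex : powerLawFamily α R f ⊆ stdSimplex ℝ X :=
  fun _ h => h.1

/-- The power-law family consists of the probability measures whose `(α - 1)`-th power is a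
positive combination of `R ^ (α - 1)` and the `f i` with positive coefficient at `R ^ (α - 1)`. -/
theorem mem_powerLawFamily_iff (hα : 1 < α) :
    P ∈ powerLawFamily α R f ↔ P ∈ stdSimplex ℝ X ∧ ∃ l : ℝ, 0 < l ∧ ∃ η : Fin k → ℝ,
      ∀ x, 0 < P x ∧ P x ^ (α - 1) = l * R x ^ (α - 1) + ∑ i, η i * f i x := by
  have hβ : 0 < α - 1 := by linarith
  have hne' : 1 - α ≠ 0 := by linarith
  constructor
  · rintro ⟨hP, θ, Z, hZ, h⟩
    have hc : 0 < Z ^ (1 - α) := Real.rpow_pos_of_pos hZ _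
    refine ⟨hP, Z ^ (1 - α), hc, fun i => Z ^ (1 - α) * (1 - α) * θ i, fun x => ⟨?_, ?_⟩⟩
    · refine (hP.1 x).lt_of_ne fun h0 => ?_
      have h1 := mul_pos hc (h x).1
      rw [← (h x).2, ← h0, Real.zero_rpow hβ.ne'] at h1
      exact lt_irrefl _ h1
    · rw [(h x).2, mul_add]
      congr 1
      rw [Finset.mul_sum, Finset.mul_sum]
      exact Finset.sum_congr rfl fun _ _ => by ring
  · rintro ⟨hP, l, hl, η, h⟩
    have e : ∀ x, R x ^ (α - 1) + (1 - α) * ∑ i, η i / ((1 - α) * l) * f i x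
        = P x ^ (α - 1) / l := by
      intro x
      have : ∑ i, η i / ((1 - α) * l) * f i x = (∑ i, η i * f i x) / ((1 - α) * l) := by
        rw [Finset.sum_div]; exact Finset.sum_congr rfl fun _ _ => by ring
      rw [this, (h x).2]; field_simp
    refine ⟨hP, fun i => η i / ((1 - α) * l), l ^ (1 / (1 - α)), Real.rpow_pos_of_pos hl _,
      fun x => ⟨?_, ?_⟩⟩
    · rw [e]; exact div_pos (Real.rpow_pos_of_pos (h x).1 _) hl
    · rw [e, ← Real.rpow_mul hl.le, one_div_mul_cancel hne', Real.rpow_one]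
      field_simp

/-- The coefficient `τ i` in the definition of `tilted`. -/
noncomputable def tiltCoeff (α : ℝ) (Phat R : X → ℝ) (f : Fin k → X → ℝ) (i : Fin k) : ℝ :=
  (∑ y, Phat y * f i y) / alphaPairing α Phat R

theorem tilted_apply (i : Fin k) (x : X) :
    tilted α Phat R f i x = f i x - tiltCoeff α Phat R f i * R x ^ (α - 1) := rfl

theorem sum_mul_tilted (V : X → ℝ) (i : Fin k) : ∑ x, V x * tilted α Phat R f i x
    = ∑ x, V x * f i x - tiltCoeff α Phat R f i * alphaPairing α V R := by
  unfold alphaPairing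
  rw [Finset.mul_sum, ← Finset.sum_sub_distrib]
  exact Finset.sum_congr rfl fun x _ => by rw [tilted_apply]; ring

theorem mem_linearFamily_tilted (hPhat : Phat ∈ stdSimplex ℝ X) (hRpos : ∀ x, 0 < R x) :
    Phat ∈ linearFamily (tilted α Phat R f) := by
  refine ⟨hPhat, fun i => ?_⟩
  rw [sum_mul_tilted, tiltCoeff, div_mul_cancel₀ _ (alphaPairing_pos hPhat hRpos).ne', sub_self]

theorem affine_eq_tilted (l : ℝ) (η : Fin k → ℝ) (x : X) :
    l * R x ^ (α - 1) + ∑ i, η i * f i x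
      = (l + ∑ i, η i * tiltCoeff α Phat R f i) * R x ^ (α - 1)
        + ∑ i, η i * tilted α Phat R f i x := by
  simp_rw [tilted_apply, mul_sub, Finset.sum_sub_distrib, add_mul, Finset.sum_mul, mul_assoc]
  ring

theorem alphaPairing_eq_mul_of_affine {g : Fin k → X → ℝ} {V : X → ℝ} (hV : V ∈ linearFamily g)
    {l : ℝ} {η : Fin k → ℝ} (h : ∀ x, P x ^ (α - 1) = l * R x ^ (α - 1) + ∑ i, η i * g i x) :
    alphaPairing α V P = l * alphaPairing α V R := by
  have h2 := sum_mul_affine_eq hV.2 (fun x => l * R x ^ (α - 1)) 1 η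
  simp_rw [one_mul, ← h] at h2
  unfold alphaPairing
  rw [h2, Finset.mul_sum]
  exact Finset.sum_congr rfl fun x _ => by ring

/-- A power-law distribution is one for the tilted functions too: pairing with `Phat` shows that
the new coefficient at `R ^ (α - 1)` is positive. -/
theorem powerLawFamily_subset_tilted (hα : 1 < α) (hPhat : Phat ∈ stdSimplex ℝ X)
    (hRpos : ∀ x, 0 < R x) :
    powerLawFamily α R f ⊆ powerLawFamily α R (tilted α Phat R f) := by
  intro P hP
  obtain ⟨hPs, l, hl, η, h⟩ := (mem_powerLawFamily_iff hα).1 hP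
  refine (mem_powerLawFamily_iff hα).2 ⟨hPs, l + ∑ i, η i * tiltCoeff α Phat R f i, ?_, η,
    fun x => ⟨(h x).1, by rw [(h x).2, affine_eq_tilted (Phat := Phat)]⟩⟩
  have h1 := alphaPairing_eq_mul_of_affine
    (mem_linearFamily_tilted (α := α) (f := f) hPhat hRpos) fun x =>
      (h x).2.trans (affine_eq_tilted (Phat := Phat) l η x)
  refine pos_of_mul_pos_left (b := alphaPairing α Phat R) ?_ (alphaPairing_pos hPhat hRpos).le
  rw [← h1]
  exact alphaPairing_pos hPhat fun x => (h x).1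

theorem exists_hasPlusParameter_of_mem_powerLawFamily {g : Fin k → X → ℝ}
    (hP : P ∈ powerLawFamily α R g) : ∃ θ, HasPlusParameter α R g θ P := by
  obtain ⟨hPs, θ, Z, hZ, h⟩ := hP
  refine ⟨θ, hPs, Z, hZ, fun x => ?_⟩
  rw [(h x).2, max_eq_left (h x).1.le, ← mul_assoc, ← Real.rpow_add hZ]
  simp

theorem pos_of_mem_powerLawFamily (hα : 1 < α) (hP : P ∈ powerLawFamily α R f) (x : X) :
    0 < P x := by
  obtain ⟨-, l, -, η, h⟩ := (mem_powerLawFamily_iff hα).1 hP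
  exact (h x).1

/-- `Phat` and any `Q` in the tilted linear family are proportional as functionals on
the closure of the power-law family. -/
theorem alphaPairing_mul_comm_of_mem_closure (hα : 1 < α) (hPhat : Phat ∈ stdSimplex ℝ X)
    (hRpos : ∀ x, 0 < R x) (hQ : Q ∈ linearFamily (tilted α Phat R f))
    (hS : S ∈ closure (powerLawFamily α R f)) :
    alphaPairing α Phat S * alphaPairing α Q R = alphaPairing α Q S * alphaPairing α Phat R := by
  refine closure_minimal (t := {S | alphaPairing α Phat S * alphaPairing α Q R
    = alphaPairing α Q S * alphaPairing α Phat R}) ?_ ?_ hS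
  · intro S hS
    obtain ⟨-, l, -, η, h⟩ := (mem_powerLawFamily_iff hα).1
      (powerLawFamily_subset_tilted hα hPhat hRpos hS)
    have key : ∀ V ∈ linearFamily (tilted α Phat R f),
        alphaPairing α V S = l * alphaPairing α V R := fun V hV =>
      alphaPairing_eq_mul_of_affine hV fun x => (h x).2
    change _ * _ = _ * _
    rw [key _ (mem_linearFamily_tilted hPhat hRpos), key _ hQ]
    ring
  · exact isClosed_eq ((continuous_alphaPairing_right hα).mul continuous_const)
      ((continuous_alphaPairing_right hα).mul continuous_const)

theorem closure_powerLawFamily_subset_stdSimplex :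
    closure (powerLawFamily α R f) ⊆ stdSimplex ℝ X :=
  closure_minimal powerLawFamily_subset_stdSimplex (isCompact_stdSimplex ℝ X).isClosed

/-- A strict minimizer is the one and only reverse projection. -/
theorem isUniqueReverseProj_of_lt (hα : 1 < α) (hPhat : Phat ∈ stdSimplex ℝ X)
    {E : Set (X → ℝ)} (hE : E ⊆ stdSimplex ℝ X) (hQ : Q ∈ E) (hpos : 0 < alphaPairing α Phat Q)
    (h : ∀ S ∈ E, S ≠ Q → alphaMass α Q ^ (α - 1) * alphaPairing α Phat S ^ α
      < alphaMass α S ^ (α - 1) * alphaPairing α Phat Q ^ α) :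
    IsUniqueReverseProj α Phat E Q := by
  refine ⟨(isReverseProj_iff hα hPhat hE).2 ⟨hQ, hpos, fun S hS => ?_⟩, fun S hS => ?_⟩
  · rcases eq_or_ne S Q with rfl | hne
    · exact le_rfl
    · exact (h S hS hne).le
  · by_contra hne
    obtain ⟨hS, -, hmin⟩ := (isReverseProj_iff hα hPhat hE).1 hS
    exact (h S hS hne).not_ge (hmin Q hQ)

theorem isUniqueReverseProj_of_subset_closure (hα : 1 < α) (hPhat : Phat ∈ stdSimplex ℝ X)
    (hRpos : ∀ x, 0 < R x) (hQ : Q ∈ linearFamily (tilted α Phat R f)) {E : Set (X → ℝ)}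
    (hE : E ⊆ closure (powerLawFamily α R f)) (hQE : Q ∈ E) :
    IsUniqueReverseProj α Phat E Q := by
  have hcomm : ∀ S ∈ E, _ := fun S hS =>
    alphaPairing_mul_comm_of_mem_closure hα hPhat hRpos hQ (hE hS)
  have hQR : 0 < alphaPairing α Q R := alphaPairing_pos hQ.1 hRpos
  have hPR : 0 < alphaPairing α Phat R := alphaPairing_pos hPhat hRpos
  have hQQ := hcomm Q hQE
  rw [alphaPairing_self hα hQ.1] at hQQ
  have hpos : 0 < alphaPairing α Phat Q := by
    refine pos_of_mul_pos_left (b := alphaPairing α Q R) ?_ hQR.le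
    rw [hQQ]
    exact mul_pos (alphaMass_pos hQ.1) hPR
  have hEs := hE.trans closure_powerLawFamily_subset_stdSimplex
  refine isUniqueReverseProj_of_lt hα hPhat hEs hQE hpos fun S hS hne => ?_
  refine reverse_lt_of_alphaPairing_le hα hPhat hQ.1 (hEs hS) hne hpos ?_
  refine le_of_mul_le_mul_right (a := alphaPairing α Phat R) (le_of_eq ?_) hPR
  calc alphaPairing α Phat S * alphaMass α Q * alphaPairing α Phat R
      = alphaPairing α Phat S * alphaPairing α Q R * alphaPairing α Phat Q := by
        rw [mul_assoc, ← hQQ]; ring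
    _ = _ := by rw [hcomm S hS]; ring

/-! ### Reverse projections on the power-law family -/

/-- Minimality on the power-law family, extended by homogeneity to the positive functions
`l * R ^ (α - 1) + ∑ i, η i * f i` that represent its members up to scale. -/
theorem reverse_le_of_affine (hα : 1 < α)
    (hmin : ∀ T ∈ powerLawFamily α R f, alphaMass α S ^ (α - 1) * alphaPairing α Phat T ^ α
      ≤ alphaMass α T ^ (α - 1) * alphaPairing α Phat S ^ α)
    (hPhat : Phat ∈ stdSimplex ℝ X) {l : ℝ} (hl : 0 < l) {η : Fin k → ℝ} {v : X → ℝ}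
    (hv : ∀ x, 0 < v x) (hvl : ∀ x, v x = l * R x ^ (α - 1) + ∑ i, η i * f i x) :
    alphaMass α S ^ (α - 1) * (∑ x, Phat x * v x) ^ α
      ≤ (∑ x, v x ^ (α / (α - 1))) ^ (α - 1) * alphaPairing α Phat S ^ α := by
  have hβ : 0 < α - 1 := by linarith
  have hu : ∀ x, 0 < v x ^ (1 / (α - 1)) := fun x => Real.rpow_pos_of_pos (hv x) _
  set N := ∑ x, v x ^ (1 / (α - 1)) with hN
  have hN0 : 0 < N := by
    obtain ⟨x, -⟩ := exists_pos_of_mem_stdSimplex hPhat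
    exact Finset.sum_pos (fun x _ => hu x) ⟨x, Finset.mem_univ x⟩
  have hpow : ∀ x, (v x ^ (1 / (α - 1)) / N) ^ (α - 1) = v x / N ^ (α - 1) := fun x => by
    rw [Real.div_rpow (hu x).le hN0.le, ← Real.rpow_mul (hv x).le, one_div_mul_cancel hβ.ne',
      Real.rpow_one]
  have hNβ : 0 < N ^ (α - 1) := Real.rpow_pos_of_pos hN0 _
  have h := hmin (fun x => v x ^ (1 / (α - 1)) / N) ((mem_powerLawFamily_iff hα).2
    ⟨⟨fun x => (div_pos (hu x) hN0).le, by rw [← Finset.sum_div, ← hN, div_self hN0.ne']⟩,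
      l / N ^ (α - 1), div_pos hl hNβ, fun i => η i / N ^ (α - 1), fun x =>
        ⟨div_pos (hu x) hN0, by
          rw [hpow, hvl, add_div, Finset.sum_div]
          congr 1
          · ring
          · exact Finset.sum_congr rfl fun _ _ => by ring⟩⟩)
  have e1 : alphaPairing α Phat (fun x => v x ^ (1 / (α - 1)) / N)
      = (∑ x, Phat x * v x) / N ^ (α - 1) := by
    unfold alphaPairing
    rw [Finset.sum_div]
    exact Finset.sum_congr rfl fun x _ => by rw [hpow, mul_div_assoc]
  have e2 : alphaMass α (fun x => v x ^ (1 / (α - 1)) / N)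
      = (∑ x, v x ^ (α / (α - 1))) / N ^ α := by
    unfold alphaMass
    rw [Finset.sum_div]
    refine Finset.sum_congr rfl fun x _ => ?_
    rw [Real.div_rpow (hu x).le hN0.le, ← Real.rpow_mul (hv x).le, one_div_mul_eq_div]
  have hM : 0 ≤ ∑ x, v x ^ (α / (α - 1)) :=
    Finset.sum_nonneg fun x _ => Real.rpow_nonneg (hv x).le _
  rw [e1, e2, Real.div_rpow (sum_mul_pos_of_mem_stdSimplex hPhat hv).le hNβ.le,
    Real.div_rpow hM (Real.rpow_nonneg hN0.le _), ← Real.rpow_mul hN0.le,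
    ← Real.rpow_mul hN0.le, mul_comm (α - 1) α, mul_div_assoc', div_mul_eq_mul_div] at h
  exact (div_le_div_iff_of_pos_right (Real.rpow_pos_of_pos hN0 _)).1 h

/-- First-order condition: since the power-law family is relatively open, a reverse projection on
it is stationary in each direction `tilted α Phat R f i`. The pairing with `Phat` is constant in
such a direction, so stationarity says that the measure lies in the tilted linear family. -/
theorem mem_linearFamily_tilted_of_isReverseProj (hα : 1 < α) (hPhat : Phat ∈ stdSimplex ℝ X)
    (hRpos : ∀ x, 0 < R x) (hS : IsReverseProj α Phat (powerLawFamily α R f) S) :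
    S ∈ linearFamily (tilted α Phat R f) := by
  have hβ : 0 < α - 1 := by linarith
  obtain ⟨hSM, hpos, hmin⟩ := (isReverseProj_iff hα hPhat powerLawFamily_subset_stdSimplex).1 hS
  obtain ⟨hSs, l, hl, η, h⟩ := (mem_powerLawFamily_iff hα).1 hSM
  refine ⟨hSs, fun i => ?_⟩
  set d := tilted α Phat R f i with hd
  set τ := tiltCoeff α Phat R f i with hτ
  have hloc : IsLocalMin (fun t : ℝ => ∑ x, (S x ^ (α - 1) + t * d x) ^ (α / (α - 1))) 0 := by
    have h1 : ∀ᶠ t : ℝ in nhds 0, 0 < l - t * τ :=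
      (show ContinuousAt (fun t : ℝ => l - t * τ) 0 by fun_prop).eventually_const_lt (by simpa)
    have h2 : ∀ᶠ t : ℝ in nhds 0, ∀ x, 0 < S x ^ (α - 1) + t * d x := by
      refine Filter.eventually_all.2 fun x => ?_
      refine (show ContinuousAt (fun t : ℝ => S x ^ (α - 1) + t * d x) 0 by
        fun_prop).eventually_const_lt ?_
      simpa using Real.rpow_pos_of_pos (h x).1 (α - 1)
    filter_upwards [h1, h2] with t ht1 ht2
    have h3 := reverse_le_of_affine (η := fun j => η j + if j = i then t else 0) hα hmin hPhat ht1
      ht2 (fun x => by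
        simp only [add_mul, Finset.sum_add_distrib, ite_mul, zero_mul, Finset.sum_ite_eq',
          Finset.mem_univ, if_true]
        rw [(h x).2, hd, tilted_apply]
        ring)
    have h4 : ∑ x, Phat x * (S x ^ (α - 1) + t * d x) = alphaPairing α Phat S := by
      have h5 := (mem_linearFamily_tilted (α := α) (f := f) hPhat hRpos).2 i
      rw [← hd] at h5
      simp_rw [mul_add, Finset.sum_add_distrib, mul_left_comm _ t, ← Finset.mul_sum]
      rw [h5, mul_zero, add_zero]
      rfl
    rw [h4] at h3
    have h6 := le_of_mul_le_mul_right h3 (Real.rpow_pos_of_pos hpos α)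
    rw [Real.rpow_le_rpow_iff (alphaMass_pos hSs).le
      (Finset.sum_nonneg fun x _ => Real.rpow_nonneg (ht2 x).le _) hβ] at h6
    refine le_of_eq_of_le ?_ h6
    unfold alphaMass
    refine Finset.sum_congr rfl fun x _ => ?_
    rw [zero_mul, add_zero, ← Real.rpow_mul (hSs.1 x), mul_div_cancel₀ _ hβ.ne']
  have hder := hloc.hasDerivAt_eq_zero (hasDerivAt_sum_add_mul_rpow
    ((one_le_div hβ).2 (by linarith)) (fun x => S x ^ (α - 1)) d)
  -- `S ^ (α - 1)` raised to the power `α / (α - 1) - 1 = 1 / (α - 1)` is `S`.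
  have e : ∑ x, d x * (α / (α - 1) * (S x ^ (α - 1)) ^ (α / (α - 1) - 1))
      = α / (α - 1) * ∑ x, S x * d x := by
    rw [Finset.mul_sum]
    refine Finset.sum_congr rfl fun x _ => ?_
    rw [← Real.rpow_mul (hSs.1 x), show (α - 1) * (α / (α - 1) - 1) = 1 by field_simp; ring,
      Real.rpow_one]
    ring
  rw [e] at hder
  exact (mul_eq_zero.1 hder).resolve_left (div_pos (by linarith) hβ).ne'

/-- A reverse projection on the power-law family satisfies the optimality conditions of the
forward problem, hence is the forward projection. -/
theorem eq_forwardProj_of_isReverseProj (hα : 1 < α) (hPhat : Phat ∈ stdSimplex ℝ X)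
    (hR : R ∈ stdSimplex ℝ X) (hRpos : ∀ x, 0 < R x)
    (hQ : IsForwardProj α R (linearFamily (tilted α Phat R f)) Q)
    (hS : IsReverseProj α Phat (powerLawFamily α R f) S) : Q = S := by
  obtain ⟨θ, hθ⟩ := exists_hasPlusParameter_of_mem_powerLawFamily
    (powerLawFamily_subset_tilted hα hPhat hRpos hS.2.1)
  exact isForwardProj_unique hα hR hRpos hQ
    (mem_linearFamily_tilted_of_isReverseProj hα hPhat hRpos hS) hθ

/-! ### Reverse projections on the extended family -/

theorem extendedPowerLawFamily_subset_stdSimplex {g : Fin k → X → ℝ} {θs : Fin k → ℝ} :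
    extendedPowerLawFamily α R g Q θs ⊆ stdSimplex ℝ X :=
  fun _ ⟨_, h, _⟩ => h.1

/-- Members of the extended family have a smaller truncated part than `Q`; hence they pair with
`Phat` at most like `Q` does, while pairing with `Q` in the same way. -/
theorem isUniqueReverseProj_extendedPowerLawFamily {g : Fin k → X → ℝ} (hα : 1 < α)
    (hRpos : ∀ x, 0 < R x) (hPhat : Phat ∈ linearFamily g) (hQ : Q ∈ linearFamily g)
    {θs : Fin k → ℝ} (hθs : HasPlusParameter α R g θs Q) :
    IsUniqueReverseProj α Phat (extendedPowerLawFamily α R g Q θs) Q := by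
  have hβ : 0 < α - 1 := by linarith
  have hQmem : Q ∈ extendedPowerLawFamily α R g Q θs := ⟨θs, hθs, subset_rfl, fun _ _ => le_rfl⟩
  obtain ⟨-, Zs, hZs, hcs⟩ := hθs
  have hcs0 : 0 < Zs ^ (α - 1) := Real.rpow_pos_of_pos hZs _
  have hPR : 0 < alphaPairing α Phat R := alphaPairing_pos hPhat.1 hRpos
  have h1 := mul_alphaPairing_of_plusParameter hPhat hcs
  have h2 := mul_alphaPairing_of_plusParameter hQ hcs
  rw [sum_mul_bracketNegPart_eq_zero hcs0 hQ.1 hcs fun _ h => h, add_zero,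
    alphaPairing_self hα hQ.1] at h2
  have hpos : 0 < alphaPairing α Phat Q := by
    refine pos_of_mul_pos_right (a := Zs ^ (α - 1)) ?_ hcs0.le
    rw [h1]
    exact add_pos_of_pos_of_nonneg hPR
      (Finset.sum_nonneg fun x _ => mul_nonneg (hPhat.1.1 x) (le_max_right _ _))
  refine isUniqueReverseProj_of_lt hα hPhat.1 extendedPowerLawFamily_subset_stdSimplex hQmem hpos
    fun S hS hne => ?_
  have hSs := extendedPowerLawFamily_subset_stdSimplex hS
  refine reverse_lt_of_alphaPairing_le hα hPhat.1 hQ.1 hSs hne hpos ?_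
  obtain ⟨θ, ⟨-, Z, hZ, hc⟩, hsupp, hoff⟩ := hS
  have hc0 : 0 < Z ^ (α - 1) := Real.rpow_pos_of_pos hZ _
  have h3 := mul_alphaPairing_of_plusParameter hPhat hc
  have h4 := mul_alphaPairing_of_plusParameter hQ hc
  rw [sum_mul_bracketNegPart_eq_zero hc0 hSs hc fun x h => hsupp h, add_zero] at h4
  have hle : ∀ x, bracketNegPart α R g θ x ≤ bracketNegPart α R g θs x := by
    intro x
    by_cases hx : S x = 0
    -- Off the support of `S` the defining condition of the extended family bounds the bracket.
    · refine max_le_max_right 0 ?_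
      have := hoff x (fun h => h hx)
      nlinarith
    · have h : 0 < max (R x ^ (α - 1) + (1 - α) * ∑ i, θ i * g i x) 0 :=
        hc x ▸ mul_pos hc0 (Real.rpow_pos_of_pos ((hSs.1 x).lt_of_ne (Ne.symm hx)) _)
      have h' := (lt_max_iff.1 h).resolve_right (lt_irrefl _)
      rw [bracketNegPart, max_eq_right (by linarith)]
      exact le_max_right _ _
  have h5 : Z ^ (α - 1) * alphaPairing α Phat S ≤ Zs ^ (α - 1) * alphaPairing α Phat Q := by
    rw [h3, h1]
    gcongr with x
    · exact hPhat.1.1 x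
    · exact hle x
  refine le_of_mul_le_mul_left ?_ (mul_pos hc0 hcs0)
  calc Z ^ (α - 1) * Zs ^ (α - 1) * (alphaPairing α Phat S * alphaMass α Q)
      = Z ^ (α - 1) * alphaPairing α Phat S * alphaPairing α Q R := by rw [← h2]; ring
    _ ≤ Zs ^ (α - 1) * alphaPairing α Phat Q * alphaPairing α Q R :=
        mul_le_mul_of_nonneg_right h5 (alphaPairing_pos hQ.1 hRpos).le
    _ = _ := by rw [← h4]; ring

theorem powerLawFamily_subset_extendedPowerLawFamily (hα : 1 < α)
    (hPhat : Phat ∈ stdSimplex ℝ X) (hRpos : ∀ x, 0 < R x) {θs : Fin k → ℝ} :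
    powerLawFamily α R f ⊆ extendedPowerLawFamily α R (tilted α Phat R f) Q θs := by
  intro P hP
  obtain ⟨θ, hθ⟩ := exists_hasPlusParameter_of_mem_powerLawFamily
    (powerLawFamily_subset_tilted hα hPhat hRpos hP)
  have hne : ∀ x, P x ≠ 0 := fun x => (pos_of_mem_powerLawFamily hα hP x).ne'
  exact ⟨θ, hθ, fun x _ => hne x, fun x hx => (hx (hne x)).elim⟩

end PowerLaw

/-! ### The forward projection relative to the power-law family and its closure -/

theorem mainTheorem2 {X : Type*} [Fintype X] {k : ℕ} (α : ℝ) (hα : 1 < α)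
    (Phat : X → ℝ) (hPhat : Phat ∈ stdSimplex ℝ X)
    (R : X → ℝ) (hR : R ∈ stdSimplex ℝ X) (hRsupp : ∀ x, 0 < R x)
    (f : Fin k → X → ℝ) (hL : (linearFamily f).Nonempty) :
    (∃! Q : X → ℝ, IsForwardProj α R (linearFamily (tilted α Phat R f)) Q) ∧
    ∀ Q : X → ℝ, IsForwardProj α R (linearFamily (tilted α Phat R f)) Q →
      (Q ∈ powerLawFamily α R f →
        IsUniqueReverseProj α Phat (powerLawFamily α R f) Q) ∧
      (Q ∈ closure (powerLawFamily α R f) \ powerLawFamily α R f →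
        (¬ ∃ S, IsReverseProj α Phat (powerLawFamily α R f) S) ∧
        IsUniqueReverseProj α Phat (closure (powerLawFamily α R f)) Q) ∧
      (Q ∉ closure (powerLawFamily α R f) →
        (¬ ∃ S, IsReverseProj α Phat (powerLawFamily α R f) S) ∧
        (∃ θs : Fin k → ℝ, HasPlusParameter α R (tilted α Phat R f) θs Q) ∧
        ∀ θs : Fin k → ℝ, HasPlusParameter α R (tilted α Phat R f) θs Q →
          powerLawFamily α R f ⊆
            extendedPowerLawFamily α R (tilted α Phat R f) Q θs ∧
          IsUniqueReverseProj α Phat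
            (extendedPowerLawFamily α R (tilted α Phat R f) Q θs) Q) := by
  have hPhatL : Phat ∈ linearFamily (tilted α Phat R f) := mem_linearFamily_tilted hPhat hRsupp
  have hparam : ∀ Q, IsForwardProj α R (linearFamily (tilted α Phat R f)) Q →
      ∃ θs : Fin k → ℝ, HasPlusParameter α R (tilted α Phat R f) θs Q := fun Q hQ => by
    obtain ⟨hQm, hmin⟩ := (isForwardProj_iff hα hR hRsupp linearFamily_subset_stdSimplex).1 hQ
    exact exists_hasPlusParameter hα hRsupp hQm hmin
  refine ⟨?_, fun Q hQ => ?_⟩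
  · obtain ⟨Q, hQ⟩ := exists_isForwardProj hα hR hRsupp ⟨Phat, hPhatL⟩
    obtain ⟨θ, hθ⟩ := hparam Q hQ
    exact ⟨Q, hQ, fun S hS => isForwardProj_unique hα hR hRsupp hS hQ.2.1 hθ⟩
  · have hQL := hQ.2.1
    have hnone : Q ∉ powerLawFamily α R f →
        ¬ ∃ S, IsReverseProj α Phat (powerLawFamily α R f) S := by
      rintro hQM ⟨S, hS⟩
      exact hQM (eq_forwardProj_of_isReverseProj hα hPhat hR hRsupp hQ hS ▸ hS.2.1)
    refine ⟨fun h => ?_, fun h => ⟨hnone h.2, ?_⟩, fun h => ⟨hnone fun h' => h (subset_closure h'),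
      hparam Q hQ, fun θs hθs => ⟨?_, ?_⟩⟩⟩
    · exact isUniqueReverseProj_of_subset_closure hα hPhat hRsupp hQL subset_closure h
    · exact isUniqueReverseProj_of_subset_closure hα hPhat hRsupp hQL subset_rfl h.1
    · exact powerLawFamily_subset_extendedPowerLawFamily hα hPhat hRsupp
    · exact isUniqueReverseProj_extendedPowerLawFamily hα hRsupp hPhatL hQL hθs
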